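/- Let $K$ be a field and let $0<n_1<n_2<n_3<n_4$ be integers with $\gcd(n_1,n_2,n_3,n_4)=1$. Let $\mathcal S=\mathbb N n_1+\cdots+\mathbb N n_4$, let $C$ be the monomial curve $x_i=t^{n_i}$ in $\mathbb A^4(K)$, and let $I(C)$ be the kernel of $K[x_1,\dots,x_4]\to K[t]$, $x_i\mapsto t^{n_i}$. The tangent cone of $C$ at the origin has coordinate ring $K[x_1,\dots,x_4]/I(C)_*$, where $I(C)_*$ is generated by the homogeneous summands of least degree of the nonzero elements of $I(C)$. For a monomial ${\bf x}^{\bf u}$ put $\deg({\bf x}^{\bf u})=\sum_i u_i$ and ${\rm supp}({\bf x}^{\bf u})=\{i: x_i \mid {\bf x}^{\bf u}\}$. For each $i$ let $a_i$ be the least positive integer with $a_in_i\in\sum_{j\ne i}\mathbb N n_j$; a binomial $x_i^{a_i}-M\in I(C)$ with $M$ a monomial not divisible by $x_i$ is called critical, and $\mathcal C_A$ is the ideal generated by all critical binomials. Assume that $a_in_i\neq a_jn_j$ for $i\ne j$ and that $\mathcal C_A$ is generated by critical binomials $x_1^{a_1}-{\bf x}^{\bf u}$, $x_2^{a_2}-{\bf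 x}^{\bf v}$, $x_3^{a_3}-{\bf x}^{\bf w}$, $x_4^{a_4}-{\bf x}^{\bf z}$, where each of ${\bf x}^{\bf u},{\bf x}^{\bf v},{\bf x}^{\bf w},{\bf x}^{\bf z}$ has support of cardinality at least two (Case 1). Assume moreover that $1\in{\rm supp}({\bf x}^{\bf v})$. A monomial is called indispensable if every system of binomial generators of $I(C)$ contains a (nonzero) binomial having it as one of its terms up to sign. Let $\mathcal I$ be the set of all binomials $x_{i_1}^{b_1}x_{i_2}^{b_2}-x_{i_3}^{b_3}x_{i_4}^{b_4}\in I(C)$ with $\{i_1,i_2,i_3,i_4\}=\{1,2,3,4\}$, $0<b_j<a_{i_j}$ for $j=1,2$, $b_3,b_4>0$ and $x_{i_3}^{b_3}x_{i_4}^{b_4}$ indispensable. Say that a monomial $M=x_2^{d_2}x_3^{d_3}x_4^{d_4}$ is good if there is a monomial $N$ with $1\in{\rm supp}(N)$, $M-N\in I(C)$ and $\deg(M)\le\deg(N)$. Then in each of the following cases $C$ has Cohen–Macaulay tangent cone at the origin, i.e. $K[x_1,\dots,x_4]/I(C)_*$ is a Cohen–Macaulay ring. (i) $1\in{\rm supp}({\bf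 x}^{\bf w})$, $1\in{\rm supp}({\bf x}^{\bf z})$, $a_2\le\deg({\bf x}^{\bf v})$, $a_3\le\deg({\bf x}^{\bf w})$, and $\deg(N)\le\deg(M)$ for every binomial $M-N\in\mathcal I$ with $1\in{\rm supp}(M)$. (ii) $1\in{\rm supp}({\bf x}^{\bf w})$, $1\notin{\rm supp}({\bf x}^{\bf z})$, $a_2\le\deg({\bf x}^{\bf v})$, $a_3\le\deg({\bf x}^{\bf w})$, and every monomial $M=x_2^{d_2}x_3^{d_3}x_4^{d_4}$ with $d_2<a_2$, $d_3<a_3$ and $d_2n_2+d_3n_3+d_4n_4\in n_1+\mathcal S$ is good. (iii) $1\notin{\rm supp}({\bf x}^{\bf w})$, $1\in{\rm supp}({\bf x}^{\bf z})$, $a_2\le\deg({\bf x}^{\bf v})$, and every monomial $M=x_2^{d_2}x_3^{d_3}x_4^{d_4}$ with $d_2<a_2$, $d_4<a_4$ and $d_2n_2+d_3n_3+d_4n_4\in n_1+\mathcal S$ is good. (iv) $1\notin{\rm supp}({\bf x}^{\bf w})$, $1\notin{\rm supp}({\bf x}^{\bf z})$, $a_2\le\deg({\bf x}^{\bf v})$,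 and every monomial $M=x_2^{d_2}x_3^{d_3}x_4^{d_4}$ with $d_2<a_2$ and $d_2n_2+d_3n_3+d_4n_4\in n_1+\mathcal S$ is good. -/

import Mathlib

namespace MonomialCurve

open MvPolynomial

/-! ### Cohen–Macaulay rings -/

/-- A local ring is Cohen–Macaulay if it is Noetherian and its maximal ideal contains a regular
sequence whose length is the Krull dimension of the ring (that is, depth equals dimension). -/
def IsCohenMacaulayLocalRing (R : Type*) [CommRing R] [IsLocalRing R] : Prop :=
  IsNoetherianRing R ∧
    ∃ rs : List R, (∀ r ∈ rs, r ∈ IsLocalRing.maximalIdeal R) ∧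
      RingTheory.Sequence.IsRegular R rs ∧ ((rs.length : ℕ) : WithBot ℕ∞) = ringKrullDim R

/-- A ring is Cohen–Macaulay if it is Noetherian and all its localizations at prime ideals are
Cohen–Macaulay local rings. -/
def IsCohenMacaulayRing (R : Type*) [CommRing R] : Prop :=
  IsNoetherianRing R ∧
    ∀ (p : Ideal R) [p.IsPrime], IsCohenMacaulayLocalRing (Localization.AtPrime p)

/-! ### Monomial curves in affine 4-space

The variables `x_1, x_2, x_3, x_4` are `X 0, X 1, X 2, X 3`, and a monomial is given by its
exponent vector in `Fin 4 →₀ ℕ`. Its degree is `Finsupp.degree`, its support is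
`Finsupp.support`. -/

/-- The numerical semigroup generated by `n_1, …, n_4`. -/
def semigroup (n : Fin 4 → ℕ) : AddSubmonoid ℕ := AddSubmonoid.closure (Set.range n)

/-- The weighted (semigroup) degree `∑ u_i n_i` of the monomial with exponent vector `u`. -/
def weightedDegree (n : Fin 4 → ℕ) (u : Fin 4 →₀ ℕ) : ℕ := ∑ i, u i * n i

/-- `m ∈ n_1 + S`. -/
def MemShift (n : Fin 4 → ℕ) (m : ℕ) : Prop := ∃ s ∈ semigroup n, m = n 0 + s

/-- The binomial `x^p - x^q`. -/
noncomputable def binomial (K : Type*) [Field K] (p q : Fin 4 →₀ ℕ) : MvPolynomial (Fin 4) K :=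
  monomial p 1 - monomial q 1

/-- The toric ideal `I(C)`: the kernel of `K[x_1, …, x_4] → K[t]`, `x_i ↦ t^{n_i}`. -/
noncomputable def toricIdeal (K : Type*) [Field K] (n : Fin 4 → ℕ) :
    Ideal (MvPolynomial (Fin 4) K) :=
  RingHom.ker (aeval (fun i => (Polynomial.X : Polynomial K) ^ n i) :
    MvPolynomial (Fin 4) K →ₐ[K] Polynomial K)

/-- `g` is the homogeneous summand of least degree of the nonzero polynomial `f`. -/
def IsInitialForm {K : Type*} [Field K] (f g : MvPolynomial (Fin 4) K) : Prop :=
  ∃ k : ℕ, g = homogeneousComponent k f ∧ g ≠ 0 ∧ ∀ j < k, homogeneousComponent j f = 0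

/-- The ideal `I_*` generated by the homogeneous summands of least degree of the elements of `I`. -/
noncomputable def initialIdeal {K : Type*} [Field K] (I : Ideal (MvPolynomial (Fin 4) K)) :
    Ideal (MvPolynomial (Fin 4) K) :=
  Ideal.span {g | ∃ f ∈ I, IsInitialForm f g}

/-- The tangent cone at the origin of the monomial curve `C`, i.e. the scheme with coordinate ring
`K[x_1, …, x_4] / I(C)_*`, is Cohen–Macaulay. -/
def HasCohenMacaulayTangentCone (K : Type*) [Field K] (n : Fin 4 → ℕ) : Prop :=
  IsCohenMacaulayRing (MvPolynomial (Fin 4) K ⧸ initialIdeal (toricIdeal K n))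

/-! ### Critical binomials -/

/-- `c` is the least positive integer such that `c n_i ∈ ∑_{j ≠ i} ℕ n_j`. -/
def IsCriticalExponent (n : Fin 4 → ℕ) (i : Fin 4) (c : ℕ) : Prop :=
  IsLeast {c : ℕ | 0 < c ∧ c * n i ∈ AddSubmonoid.closure (n '' {j | j ≠ i})} c

/-- `x_i^c - x^u` is a critical binomial with respect to `x_i`. -/
def IsCriticalBinomial (K : Type*) [Field K] (n : Fin 4 → ℕ) (i : Fin 4) (c : ℕ)
    (u : Fin 4 →₀ ℕ) : Prop :=
  IsCriticalExponent n i c ∧ u i = 0 ∧ binomial K (Finsupp.single i c) u ∈ toricIdeal K n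

/-- The critical ideal: the ideal generated by all critical binomials. -/
noncomputable def criticalIdeal (K : Type*) [Field K] (n : Fin 4 → ℕ) : Ideal (MvPolynomial (Fin 4) K) :=
  Ideal.span {f | ∃ i c u, IsCriticalBinomial K n i c u ∧ f = binomial K (Finsupp.single i c) u}

/-- Case 1 of the classification by critical binomials: `a_i n_i ≠ a_j n_j` for `i ≠ j`, and the
critical ideal is generated by critical binomials `x_i^{a_i} - x^{u_i}`, `i = 1, …, 4`, where each
`x^{u_i}` has support of cardinality at least two. -/
structure IsCaseOne (K : Type*) [Field K] (n a : Fin 4 → ℕ) (u : Fin 4 → Fin 4 →₀ ℕ) : Prop where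
  critical : ∀ i, IsCriticalBinomial K n i (a i) (u i)
  ne : ∀ i j, i ≠ j → a i * n i ≠ a j * n j
  two_le_card_support : ∀ i, 2 ≤ (u i).support.card
  span_eq : Ideal.span (Set.range fun i => binomial K (Finsupp.single i (a i)) (u i)) =
    criticalIdeal K n

/-! ### Indispensable monomials and the set `𝓘` -/

/-- `G` is a system of binomial generators of the toric ideal. -/
def IsBinomialGenerating (K : Type*) [Field K] (n : Fin 4 → ℕ)
    (G : Set (MvPolynomial (Fin 4) K)) : Prop :=
  (∀ f ∈ G, ∃ p q, f = binomial K p q) ∧ Ideal.span G = toricIdeal K n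

/-- The monomial `x^q` is indispensable: every system of binomial generators of the toric ideal
contains a binomial one of whose terms is (up to sign) `x^q`. -/
def IsIndispensableMonomial (K : Type*) [Field K] (n : Fin 4 → ℕ) (q : Fin 4 →₀ ℕ) : Prop :=
  ∀ G : Set (MvPolynomial (Fin 4) K), IsBinomialGenerating K n G → ∃ f ∈ G, q ∈ f.support

/-- The set `𝓘` of all binomials `x_i^{p_i} x_j^{p_j} - x_k^{q_k} x_l^{q_l}` in the toric ideal with
`{i, j, k, l} = {1, 2, 3, 4}`, `0 < p_i < a_i`, `0 < p_j < a_j`, `q_k, q_l > 0` and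
`x_k^{q_k} x_l^{q_l}` indispensable. -/
def indispensableSet (K : Type*) [Field K] (n a : Fin 4 → ℕ) : Set (MvPolynomial (Fin 4) K) :=
  {f | ∃ (σ : Equiv.Perm (Fin 4)) (b c d e : ℕ),
    0 < b ∧ b < a (σ 0) ∧ 0 < c ∧ c < a (σ 1) ∧ 0 < d ∧ 0 < e ∧
    f = binomial K (Finsupp.single (σ 0) b + Finsupp.single (σ 1) c)
      (Finsupp.single (σ 2) d + Finsupp.single (σ 3) e) ∧
    f ∈ toricIdeal K n ∧
    IsIndispensableMonomial K n (Finsupp.single (σ 2) d + Finsupp.single (σ 3) e)}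

/-- There is a monomial `N` with `x_1 ∣ N`, `M - N ∈ I(C)` and `deg M ≤ deg N`. -/
def HasGoodPartner (K : Type*) [Field K] (n : Fin 4 → ℕ) (M : Fin 4 →₀ ℕ) : Prop :=
  ∃ N : Fin 4 →₀ ℕ, 0 ∈ N.support ∧ binomial K M N ∈ toricIdeal K n ∧ M.degree ≤ N.degree

end MonomialCurve

/-! ### Cohen–Macaulayness of integral extensions of a domain of dimension at most one. -/

namespace MonomialCurve

/-! The tangent cone ring `R` is integral over `K[x_1]`, so it is Cohen–Macaulay as soon as nonzero
polynomials in `x_1` are nonzerodivisors on it. To see this, call a monomial tight if its degree is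
maximal in its fiber (the monomials of the same weighted degree). Modulo `I(C)_*` nontight monomials
vanish and tight ones in one fiber coincide, so `R` embeds linearly in `K[t]`
(`mem_initialIdeal_iff`). If multiplication by `x_1` preserves tightness, it acts there as
multiplication by `t^{n_1}`, which is injective.

Preservation of tightness follows if every monomial `M` free of `x_1` with weight in `n_1 + S` is
good (`isTight_add_single_zero`). If some `x_i^{a_i}` divides `M` and the critical binomial of `x_i`
has a tail that contains `x_1` and has degree at least `a_i`, substituting the tail gives the
partner. In (ii)–(iv) the remaining monomials are good by hypothesis. In (i), a minimal divisor of
`M` with another monomial in its fiber is indispensable, and `exists_partner_of_minimal` finds its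
partner. -/

theorem isCohenMacaulayRing_of_isIntegral {A R : Type*} [CommRing A] [IsDomain A] [CommRing R]
    [Algebra A R] [Algebra.IsIntegral A R] [IsNoetherianRing R] (hdim : ringKrullDim A ≤ 1)
    (hreg : ∀ a : A, a ≠ 0 → algebraMap A R a ∈ nonZeroDivisors R) : IsCohenMacaulayRing R := by
  refine ⟨inferInstance, fun p hp => ?_⟩
  have hloc : IsNoetherianRing (Localization.AtPrime p) :=
    IsLocalization.isNoetherianRing p.primeCompl _ inferInstance
  refine ⟨hloc, ?_⟩
  rw [IsLocalization.AtPrime.ringKrullDim_eq_height p]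
  by_cases hq : p.comap (algebraMap A R) = ⊥
  · refine ⟨[], by simp, .nil (Localization.AtPrime p) (Localization.AtPrime p), ?_⟩
    have : p.height = 0 := by
      rw [Ideal.height_eq_zero_iff]
      refine ⟨⟨hp, bot_le⟩, fun q hqp hle => ?_⟩
      by_contra hlt
      have := hqp.1
      -- Contraction along an integral extension is strictly monotone on primes, so a smaller prime
      -- would contract strictly below zero.
      have h := Ideal.IsIntegral.comap_lt_comap (R := A) (lt_of_le_not_ge hle hlt)
      rw [hq] at h
      exact not_lt_bot h
    simp [this]
  · obtain ⟨a, ha, ha0⟩ := Submodule.exists_mem_ne_zero_of_ne_bot hq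
    have har : algebraMap A R a ∈ p := ha
    have hr := hreg a ha0
    have hmem : algebraMap R (Localization.AtPrime p) (algebraMap A R a) ∈
        IsLocalRing.maximalIdeal (Localization.AtPrime p) :=
      (IsLocalization.AtPrime.to_map_mem_maximal_iff _ p _).2 har
    refine ⟨[algebraMap R (Localization.AtPrime p) (algebraMap A R a)], by simpa using hmem, ?_, ?_⟩
    · refine RingTheory.Sequence.IsRegular.of_isWeaklyRegular_of_mem_maximalIdeal
        (R := Localization.AtPrime p) (L := Localization.AtPrime p) ?_ ?_
      · simpa using hmem
      · rw [RingTheory.Sequence.isWeaklyRegular_cons_iff]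
        refine ⟨?_, .nil (Localization.AtPrime p) _⟩
        have h := IsLocalization.map_nonZeroDivisors_le p.primeCompl (Localization.AtPrime p)
          (Submonoid.mem_map_of_mem _ hr)
        exact (isRegular_iff_mem_nonZeroDivisors.2 h).left.isSMulRegular
    · have h1 : 1 ≤ p.height :=
        (Ideal.one_le_height_span_singleton_of_mem_nonZeroDivisors hr).trans
          (Ideal.height_mono (by simpa [Ideal.span_le] using har))
      -- Strict monotonicity of contraction also bounds the dimension of `R` by that of `A`.
      have h2 : (p.height : WithBot ℕ∞) ≤ 1 := by
        refine Ideal.height_le_ringKrullDim_of_isPrime.trans (le_trans ?_ hdim)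
        exact Order.krullDim_le_of_strictMono (PrimeSpectrum.comap (algebraMap A R))
          fun P Q h => Ideal.IsIntegral.comap_lt_comap (R := A) (I := P.asIdeal) (J := Q.asIdeal) h
      have h3 : p.height = 1 := le_antisymm (by exact_mod_cast h2) h1
      simp [h3]

end MonomialCurve

/-! ### Tight monomials, the initial ideal, and regularity of `x_1`. -/

namespace MonomialCurve

open MvPolynomial

variable {K : Type*} [Field K] {n : Fin 4 → ℕ}

@[simp]
theorem weightedDegree_add (n : Fin 4 → ℕ) (p q : Fin 4 →₀ ℕ) :
    weightedDegree n (p + q) = weightedDegree n p + weightedDegree n q := by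
  simp [weightedDegree, add_mul, Finset.sum_add_distrib]

@[simp]
theorem weightedDegree_single (n : Fin 4 → ℕ) (i : Fin 4) (c : ℕ) :
    weightedDegree n (Finsupp.single i c) = c * n i := by
  simp [weightedDegree, Finsupp.single_apply]

theorem aeval_monomial_eq_monomial (n : Fin 4 → ℕ) (p : Fin 4 →₀ ℕ) (c : K) :
    aeval (fun i => (Polynomial.X : Polynomial K) ^ n i) (monomial p c) =
      Polynomial.monomial (weightedDegree n p) c := by
  rw [aeval_monomial, Finsupp.prod_fintype _ _ (by simp)]
  simp only [← pow_mul, Finset.prod_pow_eq_pow_sum, weightedDegree]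
  simp_rw [mul_comm (n _)]
  rw [← Polynomial.C_mul_X_pow_eq_monomial]
  rfl

theorem binomial_mem_toricIdeal_iff {p q : Fin 4 →₀ ℕ} :
    binomial K p q ∈ toricIdeal K n ↔ weightedDegree n p = weightedDegree n q := by
  rw [toricIdeal, RingHom.mem_ker, binomial, map_sub, sub_eq_zero]
  erw [aeval_monomial_eq_monomial, aeval_monomial_eq_monomial]
  rw [Polynomial.monomial_left_inj one_ne_zero]

theorem degree_eq_sum (u : Fin 4 →₀ ℕ) : u.degree = ∑ i, u i :=
  Finsupp.degree_eq_sum u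

theorem degree_le_weightedDegree (hpos : ∀ i, 0 < n i) (u : Fin 4 →₀ ℕ) :
    u.degree ≤ weightedDegree n u := by
  rw [degree_eq_sum]
  exact Finset.sum_le_sum fun i _ => Nat.le_mul_of_pos_right _ (hpos i)

/-- The exponent vector `u` has maximal degree among those of the same weighted degree. -/
def IsTight (n : Fin 4 → ℕ) (u : Fin 4 →₀ ℕ) : Prop :=
  ∀ v, weightedDegree n v = weightedDegree n u → v.degree ≤ u.degree

theorem IsTight.of_add {u e : Fin 4 →₀ ℕ} (h : IsTight n (u + e)) : IsTight n u := by
  intro v hv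
  have := h (v + e) (by simp [hv])
  simpa using this

theorem IsTight.degree_eq {u v : Fin 4 →₀ ℕ} (hu : IsTight n u) (hv : IsTight n v)
    (h : weightedDegree n u = weightedDegree n v) : u.degree = v.degree :=
  le_antisymm (hv u h) (hu v h.symm)

theorem IsTight.of_degree_eq {u v : Fin 4 →₀ ℕ} (hu : IsTight n u)
    (h : weightedDegree n v = weightedDegree n u) (hd : v.degree = u.degree) : IsTight n v :=
  fun z hz => hd ▸ hu z (hz.trans h)

open Classical in
/-- The linear map sending `x^u` to `t^s`, where `s` is the weighted degree of `u`, if `u` is tight,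
and to zero otherwise. Its kernel is the initial ideal of the toric ideal. -/
noncomputable def tightMap (K : Type*) [Field K] (n : Fin 4 → ℕ) :
    MvPolynomial (Fin 4) K →ₗ[K] Polynomial K :=
  (basisMonomials (Fin 4) K).constr K fun u =>
    if IsTight n u then Polynomial.monomial (weightedDegree n u) 1 else 0

open Classical in
theorem tightMap_monomial_one (u : Fin 4 →₀ ℕ) :
    tightMap K n (monomial u 1) =
      if IsTight n u then Polynomial.monomial (weightedDegree n u) 1 else 0 := by
  have := (basisMonomials (Fin 4) K).constr_basis K (fun u =>
    if IsTight n u then Polynomial.monomial (weightedDegree n u) (1 : K) else 0) u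
  rwa [coe_basisMonomials] at this

open Classical in
theorem tightMap_monomial (u : Fin 4 →₀ ℕ) (c : K) :
    tightMap K n (monomial u c) =
      if IsTight n u then Polynomial.monomial (weightedDegree n u) c else 0 := by
  have : (monomial u c : MvPolynomial (Fin 4) K) = c • monomial u 1 := by
    simp [smul_monomial]
  rw [this, map_smul, tightMap_monomial_one]
  split_ifs <;> simp [Polynomial.smul_monomial]

open Classical in
-- For tight `u`, whether `u + e` is tight depends only on the weighted degree of `u`, and for
-- nontight `u` it never is. Hence multiplication by `x^e` descends to a linear map `T` of `K[t]`.
theorem tightMap_monomial_mul_eq_zero (e : Fin 4 →₀ ℕ) {g : MvPolynomial (Fin 4) K}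
    (hg : tightMap K n g = 0) : tightMap K n (monomial e 1 * g) = 0 := by
  let T : Polynomial K →ₗ[K] Polynomial K := (Polynomial.basisMonomials K).constr K fun s =>
    if ∃ u, weightedDegree n u = s ∧ IsTight n (u + e) then
      Polynomial.monomial (s + weightedDegree n e) 1 else 0
  have hT : ∀ s, T (Polynomial.monomial s 1) =
      if ∃ u, weightedDegree n u = s ∧ IsTight n (u + e) then
        Polynomial.monomial (s + weightedDegree n e) 1 else 0 := by
    intro s
    have := (Polynomial.basisMonomials K).constr_basis K (fun s =>
      if ∃ u, weightedDegree n u = s ∧ IsTight n (u + e) then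
        Polynomial.monomial (s + weightedDegree n e) (1 : K) else 0) s
    rwa [Polynomial.coe_basisMonomials] at this
  have key : (tightMap K n).comp (LinearMap.mulLeft K (monomial e 1)) = T.comp (tightMap K n) := by
    refine (basisMonomials (Fin 4) K).ext fun u => ?_
    simp only [coe_basisMonomials, LinearMap.comp_apply, LinearMap.mulLeft_apply, monomial_mul,
      mul_one, tightMap_monomial]
    by_cases hu : IsTight n u
    · have : IsTight n (e + u) ↔
          ∃ v, weightedDegree n v = weightedDegree n u ∧ IsTight n (v + e) := by
        refine ⟨fun h => ⟨u, rfl, add_comm e u ▸ h⟩, fun ⟨v, hv, hve⟩ => hve.of_degree_eq ?_ ?_⟩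
        · simp [hv, add_comm]
        · simp [hu.degree_eq hve.of_add hv.symm, add_comm]
      simp only [if_pos hu, hT, this]
      simp [add_comm]
    · have : ¬ IsTight n (e + u) := fun h => hu (add_comm e u ▸ h).of_add
      simp [hu, this]
  have := LinearMap.congr_fun key g
  simpa [hg] using this

theorem tightMap_mul_eq_zero (f : MvPolynomial (Fin 4) K) {g : MvPolynomial (Fin 4) K}
    (hg : tightMap K n g = 0) : tightMap K n (f * g) = 0 := by
  induction f using MvPolynomial.induction_on' with
  | monomial u c =>
    have : (monomial u c : MvPolynomial (Fin 4) K) * g = c • (monomial u 1 * g) := by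
      rw [← smul_mul_assoc, smul_monomial, smul_eq_mul, mul_one]
    rw [this, map_smul, tightMap_monomial_mul_eq_zero u hg, smul_zero]
  | add p q hp hq => rw [add_mul, map_add, hp, hq, add_zero]

/-- Only weights `s` whose maximal fiber degree is the initial degree `k` can contribute. For those,
every term of `f` of weight `s` has degree at least `k`, hence exactly `k`, and is tight; so the
coefficient of `t^s` is that of the image of `f` in `K[t]`, namely zero. -/
theorem tightMap_eq_zero_of_isInitialForm {f g : MvPolynomial (Fin 4) K}
    (hf : f ∈ toricIdeal K n) (hfg : IsInitialForm f g) : tightMap K n g = 0 := by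
  classical
  obtain ⟨k, rfl, -, hlow⟩ := hfg
  ext s
  rw [homogeneousComponent_apply, map_sum, Polynomial.finsetSum_coeff, Polynomial.coeff_zero]
  by_cases hs : ∃ v, IsTight n v ∧ weightedDegree n v = s ∧ v.degree = k
  · obtain ⟨v, hv, rfl, rfl⟩ := hs
    have h0 : (aeval (fun i => (Polynomial.X : Polynomial K) ^ n i) f).coeff
        (weightedDegree n v) = 0 := by
      have : aeval (fun i => (Polynomial.X : Polynomial K) ^ n i) f = 0 := hf
      simp [this]
    conv_lhs at h0 => rw [f.as_sum]
    simp only [map_sum, aeval_monomial_eq_monomial, Polynomial.finsetSum_coeff] at h0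
    rw [← h0, Finset.sum_filter]
    refine Finset.sum_congr rfl fun u hu => ?_
    have hle : v.degree ≤ u.degree := by
      by_contra! hlt
      have := congrArg (coeff u) (hlow _ hlt)
      rw [coeff_homogeneousComponent, if_pos rfl] at this
      exact mem_support_iff.1 hu (by simpa using this)
    rw [Polynomial.coeff_monomial, tightMap_monomial]
    by_cases hw : weightedDegree n u = weightedDegree n v
    · have hd : u.degree = v.degree := le_antisymm (hv u hw) hle
      simp [hd, hv.of_degree_eq hw hd, hw]
    · split_ifs <;> simp [Polynomial.coeff_monomial, hw]
  · refine Finset.sum_eq_zero fun u hu => ?_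
    rw [tightMap_monomial]
    split_ifs with ht
    · rw [Polynomial.coeff_monomial, if_neg]
      exact fun hw => hs ⟨u, ht, hw, (Finset.mem_filter.1 hu).2⟩
    · simp

theorem tightMap_eq_zero_of_mem_initialIdeal {g : MvPolynomial (Fin 4) K}
    (hg : g ∈ initialIdeal (toricIdeal K n)) : tightMap K n g = 0 := by
  induction hg using Submodule.span_induction with
  | mem g hg =>
    obtain ⟨f, hf, hfg⟩ := hg
    exact tightMap_eq_zero_of_isInitialForm hf hfg
  | zero => simp
  | add x y _ _ hx hy => simp [hx, hy]
  | smul a x _ hx => exact tightMap_mul_eq_zero a hx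

theorem homogeneousComponent_monomial (k : ℕ) (u : Fin 4 →₀ ℕ) (c : K) :
    homogeneousComponent k (monomial u c) = if k = u.degree then monomial u c else 0 :=
  homogeneousComponent_of_mem (isHomogeneous_monomial c rfl)

theorem monomial_mem_initialIdeal {u v : Fin 4 →₀ ℕ}
    (h : weightedDegree n u = weightedDegree n v) (hd : u.degree < v.degree) :
    monomial u 1 ∈ initialIdeal (toricIdeal K n) := by
  refine Ideal.subset_span ⟨binomial K u v, binomial_mem_toricIdeal_iff.2 h, u.degree, ?_, ?_, ?_⟩
  · simp [binomial, homogeneousComponent_monomial, hd.ne]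
  · simp
  · intro j hj
    simp [binomial, homogeneousComponent_monomial, hj.ne, (hj.trans hd).ne]

theorem binomial_mem_initialIdeal {u v : Fin 4 →₀ ℕ}
    (h : weightedDegree n u = weightedDegree n v) (hd : u.degree = v.degree) :
    binomial K u v ∈ initialIdeal (toricIdeal K n) := by
  by_cases h0 : binomial K u v = 0
  · rw [h0]
    exact zero_mem _
  refine Ideal.subset_span ⟨binomial K u v, binomial_mem_toricIdeal_iff.2 h, u.degree, ?_, h0, ?_⟩
  · simp [binomial, homogeneousComponent_monomial, hd]
  · intro j hj
    simp [binomial, homogeneousComponent_monomial, hj.ne, (hd ▸ hj).ne]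

open Classical in
-- For the converse, the quotient map modulo `I_*` factors through `tightMap`: `T` sends `t^s` to
-- the class of a chosen tight monomial of weight `s`.
theorem mem_initialIdeal_iff {g : MvPolynomial (Fin 4) K} :
    g ∈ initialIdeal (toricIdeal K n) ↔ tightMap K n g = 0 := by
  refine ⟨tightMap_eq_zero_of_mem_initialIdeal, fun hg => ?_⟩
  let J := initialIdeal (toricIdeal K n)
  -- The default value `0` is harmless: `r` only matters at weights of tight monomials.
  let r : ℕ → Fin 4 →₀ ℕ := fun s =>
    if h : ∃ u, IsTight n u ∧ weightedDegree n u = s then h.choose else 0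
  have hr : ∀ u, IsTight n u → IsTight n (r (weightedDegree n u)) ∧
      weightedDegree n (r (weightedDegree n u)) = weightedDegree n u := by
    intro u hu
    have h : ∃ v, IsTight n v ∧ weightedDegree n v = weightedDegree n u := ⟨u, hu, rfl⟩
    simp only [r, dif_pos h]
    exact h.choose_spec
  let T : Polynomial K →ₗ[K] MvPolynomial (Fin 4) K ⧸ J :=
    (Polynomial.basisMonomials K).constr K fun s => Ideal.Quotient.mk J (monomial (r s) 1)
  have hT : ∀ s, T (Polynomial.monomial s 1) = Ideal.Quotient.mk J (monomial (r s) 1) := by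
    intro s
    have := (Polynomial.basisMonomials K).constr_basis K
      (fun s => Ideal.Quotient.mk J (monomial (r s) (1 : K))) s
    rwa [Polynomial.coe_basisMonomials] at this
  have key : T.comp (tightMap K n) = (Ideal.Quotient.mkₐ K J).toLinearMap := by
    refine (basisMonomials (Fin 4) K).ext fun u => ?_
    simp only [coe_basisMonomials, LinearMap.comp_apply, tightMap_monomial, AlgHom.toLinearMap_apply,
      Ideal.Quotient.mkₐ_eq_mk]
    split_ifs with hu
    · rw [hT, Ideal.Quotient.eq]
      exact binomial_mem_initialIdeal (hr u hu).2 ((hr u hu).1.degree_eq hu (hr u hu).2)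
    · rw [map_zero, eq_comm, Ideal.Quotient.eq_zero_iff_mem]
      simp only [IsTight, not_forall, not_le] at hu
      obtain ⟨v, hv, hd⟩ := hu
      exact monomial_mem_initialIdeal hv.symm hd
  have := LinearMap.congr_fun key g
  simp only [LinearMap.comp_apply, hg, map_zero] at this
  exact Ideal.Quotient.eq_zero_iff_mem.1 this.symm

theorem tightMap_aeval_mul (h : ∀ u, IsTight n u → IsTight n (u + Finsupp.single 0 1))
    (f : Polynomial K) (g : MvPolynomial (Fin 4) K) :
    tightMap K n (Polynomial.aeval (X 0) f * g) =
      Polynomial.expand K (n 0) f * tightMap K n g := by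
  classical
  have h1 : ∀ g, tightMap K n (X 0 * g) = Polynomial.X ^ n 0 * tightMap K n g := by
    intro g
    have key : (tightMap K n).comp (LinearMap.mulLeft K (X 0)) =
        (LinearMap.mulLeft K (Polynomial.X ^ n 0)).comp (tightMap K n) := by
      refine (basisMonomials (Fin 4) K).ext fun u => ?_
      simp only [coe_basisMonomials, LinearMap.comp_apply, LinearMap.mulLeft_apply, X, monomial_mul,
        mul_one, tightMap_monomial]
      have : IsTight n (Finsupp.single 0 1 + u) ↔ IsTight n u :=
        ⟨fun H => (add_comm _ u ▸ H).of_add, fun H => add_comm u _ ▸ h u H⟩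
      rw [this]
      split_ifs
      · simp [Polynomial.X_pow_eq_monomial, Polynomial.monomial_mul_monomial]
      · simp
    exact LinearMap.congr_fun key g
  induction f using Polynomial.induction_on generalizing g with
  | C a => simp [← smul_eq_C_mul, Polynomial.smul_eq_C_mul, ← MvPolynomial.algebraMap_eq]
  | add p q hp hq => simp [add_mul, hp, hq]
  | monomial k a ih =>
    rw [pow_succ, ← mul_assoc, map_mul (Polynomial.aeval _), Polynomial.aeval_X, mul_assoc, ih, h1,
      map_mul (Polynomial.expand K _) _ Polynomial.X, Polynomial.expand_X, mul_assoc]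

/-- A competitor of `x_1 x^u` divisible by `x_1` is bounded by cancelling `x_1` and using tightness
of `u`; any other competitor is first replaced by its good partner, without loss of degree. -/
theorem isTight_add_single_zero
    (h : ∀ M : Fin 4 →₀ ℕ, M 0 = 0 → MemShift n (weightedDegree n M) → HasGoodPartner K n M)
    {u : Fin 4 →₀ ℕ} (hu : IsTight n u) : IsTight n (u + Finsupp.single 0 1) := by
  have hsub : ∀ v : Fin 4 →₀ ℕ, weightedDegree n v = weightedDegree n (u + Finsupp.single 0 1) →
      v 0 ≠ 0 → v.degree ≤ (u + Finsupp.single 0 1).degree := by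
    intro v hv h0
    have hle : Finsupp.single 0 1 ≤ v := Finsupp.single_le_iff.2 (Nat.one_le_iff_ne_zero.2 h0)
    obtain ⟨z, rfl⟩ := exists_add_of_le hle
    have := hu z (by simp at hv; omega)
    simpa [add_comm] using this
  intro v hv
  by_cases h0 : v 0 = 0
  · have hs : weightedDegree n u ∈ semigroup n := by
      refine sum_mem fun i _ => ?_
      have hi : n i ∈ semigroup n := AddSubmonoid.subset_closure ⟨i, rfl⟩
      simpa using nsmul_mem hi (u i)
    obtain ⟨N, hN0, hN, hd⟩ := h v h0 ⟨_, hs, by rw [hv]; simp [add_comm]⟩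
    exact hd.trans (hsub N ((binomial_mem_toricIdeal_iff.1 hN).symm.trans hv)
      (Finsupp.mem_support_iff.1 hN0))
  · exact hsub v hv h0

theorem hasCohenMacaulayTangentCone_of_hasGoodPartner (hpos : ∀ i, 0 < n i) (hmono : StrictMono n)
    (h : ∀ M : Fin 4 →₀ ℕ, M 0 = 0 → MemShift n (weightedDegree n M) → HasGoodPartner K n M) :
    HasCohenMacaulayTangentCone K n := by
  let J := initialIdeal (toricIdeal K n)
  have htight : ∀ u, IsTight n u → IsTight n (u + Finsupp.single 0 1) :=
    fun u hu => isTight_add_single_zero h hu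
  let φ : Polynomial K →ₐ[K] MvPolynomial (Fin 4) K ⧸ J :=
    (Ideal.Quotient.mkₐ K J).comp (Polynomial.aeval (X 0))
  let _ : Algebra (Polynomial K) (MvPolynomial (Fin 4) K ⧸ J) := φ.toRingHom.toAlgebra
  have hφ : ∀ f, algebraMap (Polynomial K) (MvPolynomial (Fin 4) K ⧸ J) f =
    Ideal.Quotient.mk J (Polynomial.aeval (X 0) f) := fun f => rfl
  have hX : ∀ i, IsIntegral (Polynomial K) (Ideal.Quotient.mk J (X i)) := by
    intro i
    by_cases hi : i = 0
    · subst hi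
      have := isIntegral_algebraMap (R := Polynomial K) (A := MvPolynomial (Fin 4) K ⧸ J)
        (x := Polynomial.X)
      rwa [hφ, Polynomial.aeval_X] at this
    · refine IsIntegral.of_pow (hpos 0) ?_
      have : Ideal.Quotient.mk J (X i) ^ n 0 = 0 := by
        rw [← map_pow, Ideal.Quotient.eq_zero_iff_mem, X_pow_eq_monomial]
        -- The monomials `x_i^{n_1}` and `x_1^{n_i}` have equal weight and `n_1 < n_i`, so `x_i` is
        -- nilpotent in the tangent cone ring.
        refine monomial_mem_initialIdeal (v := Finsupp.single 0 (n i)) (by simp [mul_comm]) ?_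
        simpa using hmono (Fin.pos_of_ne_zero hi)
      rw [this]
      exact isIntegral_zero
  have : Algebra.IsIntegral (Polynomial K) (MvPolynomial (Fin 4) K ⧸ J) := by
    refine ⟨fun x => ?_⟩
    obtain ⟨g, rfl⟩ := Ideal.Quotient.mk_surjective x
    induction g using MvPolynomial.induction_on with
    | C a =>
      have := isIntegral_algebraMap (R := Polynomial K) (A := MvPolynomial (Fin 4) K ⧸ J)
        (x := Polynomial.C a)
      rwa [hφ, Polynomial.aeval_C] at this
    | add p q hp hq => rw [map_add]; exact hp.add hq
    | mul_X p i hp => rw [map_mul]; exact hp.mul (hX i)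
  refine isCohenMacaulayRing_of_isIntegral (A := Polynomial K) ?_ ?_
  · rw [IsPrincipalIdealRing.ringKrullDim_eq_one _ (Polynomial.not_isField K)]
  · intro f hf
    refine mem_nonZeroDivisors_iff_right.2 fun x hx => ?_
    obtain ⟨g, rfl⟩ := Ideal.Quotient.mk_surjective x
    rw [hφ, ← map_mul, Ideal.Quotient.eq_zero_iff_mem, mem_initialIdeal_iff, mul_comm,
      tightMap_aeval_mul htight, mul_eq_zero] at hx
    rw [Ideal.Quotient.eq_zero_iff_mem, mem_initialIdeal_iff]
    exact hx.resolve_left ((Polynomial.expand_ne_zero (hpos 0)).2 hf)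

end MonomialCurve

/-! ### Minimal monomials with a mate, critical substitutions, and good partners. -/

namespace MonomialCurve

open MvPolynomial

variable {K : Type*} [Field K] {n a : Fin 4 → ℕ} {u : Fin 4 → Fin 4 →₀ ℕ}

/-- Some other exponent vector has the same weighted degree as `q`. -/
def HasMate (n : Fin 4 → ℕ) (q : Fin 4 →₀ ℕ) : Prop :=
  ∃ v, v ≠ q ∧ weightedDegree n v = weightedDegree n q

/-- The polynomials none of whose terms divides `x^q` form an ideal. -/
theorem coeff_eq_zero_of_mem_span {G : Set (MvPolynomial (Fin 4) K)} {q : Fin 4 →₀ ℕ}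
    (hG : ∀ f ∈ G, ∀ d ≤ q, coeff d f = 0) {h : MvPolynomial (Fin 4) K} (hh : h ∈ Ideal.span G) :
    ∀ d ≤ q, coeff d h = 0 := by
  classical
  induction hh using Submodule.span_induction with
  | mem f hf => exact hG f hf
  | zero => simp
  | add x y _ _ hx hy => exact fun d hd => by simp [hx d hd, hy d hd]
  | smul p x _ hx =>
    intro d hd
    rw [smul_eq_mul, coeff_mul]
    refine Finset.sum_eq_zero fun z hz => ?_
    have hz' : z.2 ≤ q := le_trans (Finset.HasAntidiagonal.mem_antidiagonal.1 hz ▸ le_add_self) hd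
    rw [hx z.2 hz', mul_zero]

/-- Each term of a nonzero binomial in `I(C)` has a mate, so by minimality it divides `x^q` only if
it equals `x^q`. Generators avoiding `x^q` then cannot produce `x^q - x^v`. -/
theorem isIndispensableMonomial_of_minimal {q : Fin 4 →₀ ℕ} (hq : HasMate n q)
    (hmin : ∀ d ≤ q, HasMate n d → d = q) : IsIndispensableMonomial K n q := by
  classical
  intro G ⟨hbin, hspan⟩
  by_contra! hno
  obtain ⟨v, hv, hw⟩ := hq
  have hmem : binomial K q v ∈ Ideal.span G := by
    rw [hspan]
    exact binomial_mem_toricIdeal_iff.2 hw.symm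
  have h0 := coeff_eq_zero_of_mem_span (q := q) (fun f hf d hd => ?_) hmem q le_rfl
  · simp [binomial, coeff_monomial, hv] at h0
  · by_contra hne
    obtain ⟨r, s, rfl⟩ := hbin f hf
    have hrs : weightedDegree n r = weightedDegree n s :=
      (binomial_mem_toricIdeal_iff (K := K)).1 (hspan ▸ Ideal.subset_span hf)
    have hrs' : r ≠ s := by
      rintro rfl
      simp [binomial] at hne
    have hd' : HasMate n d := by
      by_cases h1 : r = d
      · exact ⟨s, fun h => hrs' (h1.trans h.symm), by rw [← hrs, h1]⟩
      · by_cases h2 : s = d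
        · exact ⟨r, h1, by rw [hrs, h2]⟩
        · simp [binomial, coeff_monomial, h1, h2] at hne
    exact hno _ hf (mem_support_iff.2 (hmin d hd hd' ▸ hne))

theorem exists_minimal_hasMate (M : Fin 4 →₀ ℕ) (hM : HasMate n M) :
    ∃ q ≤ M, HasMate n q ∧ ∀ d ≤ q, HasMate n d → d = q := by
  induction hk : M.degree using Nat.strong_induction_on generalizing M with
  | _ k ih =>
    by_cases h : ∀ d ≤ M, HasMate n d → d = M
    · exact ⟨M, le_rfl, hM, h⟩
    · push Not at h
      obtain ⟨d, hd, hdm, hne⟩ := h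
      obtain ⟨e, rfl⟩ := exists_add_of_le hd
      have hlt : d.degree < k := by
        have : e.degree ≠ 0 := fun h0 => hne (by simp [(Finsupp.degree_eq_zero_iff e).1 h0])
        rw [← hk, map_add]
        omega
      obtain ⟨q, hq, hq'⟩ := ih _ hlt d hdm rfl
      exact ⟨q, hq.trans hd, hq'⟩

/-- Cancelling a common variable would leave a proper divisor of `x^q` with a mate. -/
theorem eq_zero_or_eq_zero_of_minimal {p q : Fin 4 →₀ ℕ}
    (hmin : ∀ d ≤ q, HasMate n d → d = q) (hpq : p ≠ q)
    (hw : weightedDegree n p = weightedDegree n q) (k : Fin 4) : p k = 0 ∨ q k = 0 := by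
  by_contra! h
  obtain ⟨p', rfl⟩ := exists_add_of_le (Finsupp.single_le_iff.2 (Nat.one_le_iff_ne_zero.2 h.1))
  obtain ⟨q', rfl⟩ := exists_add_of_le (Finsupp.single_le_iff.2 (Nat.one_le_iff_ne_zero.2 h.2))
  have := hmin q' le_add_self ⟨p', fun h => hpq (by rw [h]), by simpa using hw⟩
  have := DFunLike.congr_fun this k
  simp at this

theorem le_of_isCriticalExponent (hpos : ∀ i, 0 < n i) {k : Fin 4} {c : ℕ}
    (hc : IsCriticalExponent n k c) {p q : Fin 4 →₀ ℕ} (hpq : p ≠ q)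
    (hw : weightedDegree n p = weightedDegree n q) (hp : p k = 0) (hq : ∀ j, j ≠ k → q j = 0) :
    c ≤ q k := by
  have hq' : q = Finsupp.single k (q k) := by
    ext j
    by_cases hj : j = k
    · simp [hj]
    · simp [hq j hj, Ne.symm hj]
  refine hc.2 ⟨Nat.pos_of_ne_zero fun h0 => hpq ?_, ?_⟩
  · have h1 : q = 0 := by rw [hq', h0, Finsupp.single_zero]
    have h2 := degree_le_weightedDegree hpos p
    rw [hw, h1] at h2
    rw [h1]
    exact (Finsupp.degree_eq_zero_iff p).1 (by simpa [weightedDegree] using h2)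
  · have : q k * n k = weightedDegree n p := by
      rw [hw, hq']
      simp
    rw [this]
    refine sum_mem fun j _ => ?_
    by_cases hj : j = k
    · simp [hj, hp]
    · have hi : n j ∈ AddSubmonoid.closure (n '' {j | j ≠ k}) :=
        AddSubmonoid.subset_closure ⟨j, hj, rfl⟩
      simpa using nsmul_mem hi (p j)

/-- Replacing `x_i^{a_i}` by `x^{u_i}` in a monomial. -/
theorem exists_replace (hcase : IsCaseOne K n a u) {M : Fin 4 →₀ ℕ} {l : Fin 4}
    (hl : a l ≤ M l) : ∃ r, M = Finsupp.single l (a l) + r ∧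
      weightedDegree n (r + u l) = weightedDegree n M := by
  obtain ⟨r, rfl⟩ := exists_add_of_le (Finsupp.single_le_iff.2 hl)
  refine ⟨r, rfl, ?_⟩
  have := binomial_mem_toricIdeal_iff.1 (hcase.critical l).2.2
  simp only [weightedDegree_add, weightedDegree_single] at this ⊢
  omega

theorem hasGoodPartner_of_le (hcase : IsCaseOne K n a u) {M : Fin 4 →₀ ℕ} {l : Fin 4}
    (hl : a l ≤ M l) (h0 : 0 ∈ (u l).support) (hd : a l ≤ (u l).degree) :
    HasGoodPartner K n M := by
  obtain ⟨r, rfl, hw⟩ := exists_replace hcase hl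
  refine ⟨r + u l, ?_, binomial_mem_toricIdeal_iff.2 hw.symm, ?_⟩
  · simp only [Finsupp.mem_support_iff, Finsupp.add_apply] at h0 ⊢
    omega
  · simp only [map_add, Finsupp.degree_single]
    omega

/-- Since `n_4` is the largest weight, trading `x_4` for other variables cannot lower the degree. -/
theorem le_degree_three (hpos : ∀ i, 0 < n i) (hmono : StrictMono n) (hcase : IsCaseOne K n a u) :
    a 3 ≤ (u 3).degree := by
  have h := binomial_mem_toricIdeal_iff.1 (hcase.critical 3).2.2
  rw [weightedDegree_single] at h
  have h2 : weightedDegree n (u 3) ≤ (u 3).degree * n 3 := by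
    rw [degree_eq_sum, Finset.sum_mul]
    exact Finset.sum_le_sum fun i _ => Nat.mul_le_mul_left _ (hmono.monotone (Fin.le_last i))
  exact Nat.le_of_mul_le_mul_right (h.trans_le h2) (hpos 3)

theorem degree_mul_le_weightedDegree (hmono : StrictMono n) (q : Fin 4 →₀ ℕ) :
    q.degree * n 0 ≤ weightedDegree n q := by
  rw [degree_eq_sum, Finset.sum_mul]
  exact Finset.sum_le_sum fun i _ => Nat.mul_le_mul_left _ (hmono.monotone (Fin.zero_le i))

theorem exists_two_ne_zero {v : Fin 4 →₀ ℕ} (hv : 2 ≤ v.support.card) :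
    ∃ j k, j ≠ k ∧ v j ≠ 0 ∧ v k ≠ 0 := by
  obtain ⟨j, hj, k, hk, hjk⟩ := Finset.one_lt_card.1 hv
  exact ⟨j, k, hjk, Finsupp.mem_support_iff.1 hj, Finsupp.mem_support_iff.1 hk⟩

/-- A monomial `x^q` with `q_i < a_i` for all `i` and another monomial, coprime to it, in its fiber
has support of cardinality at least two. -/
theorem exists_two_ne_zero_of_lt (hpos : ∀ i, 0 < n i) (hcase : IsCaseOne K n a u)
    {p q : Fin 4 →₀ ℕ} (hpq : p ≠ q) (hw : weightedDegree n p = weightedDegree n q)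
    (hdisj : ∀ k, p k = 0 ∨ q k = 0) (hlt : ∀ k, q k < a k) :
    ∃ j k, j ≠ k ∧ q j ≠ 0 ∧ q k ≠ 0 := by
  by_contra! h
  have hle : ∀ k, p k = 0 → ∃ j, j ≠ k ∧ q j ≠ 0 := by
    intro k hk
    by_contra! h'
    exact (hlt k).not_ge (le_of_isCriticalExponent hpos (hcase.critical k).1 hpq hw hk h')
  by_cases hz : ∃ k, q k ≠ 0
  · obtain ⟨k, hk⟩ := hz
    obtain ⟨j, hj, hj'⟩ := hle k ((hdisj k).resolve_right hk)
    exact hj' (h k j hj.symm hk)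
  · push Not at hz
    have h1 : q = 0 := Finsupp.ext hz
    have h2 := degree_le_weightedDegree hpos p
    rw [hw, h1] at h2
    exact hpq (h1 ▸ (Finsupp.degree_eq_zero_iff p).1 (by simpa [weightedDegree] using h2))

theorem injective_vec_four {s t j k : Fin 4} (hst : s ≠ t) (hsj : s ≠ j) (hsk : s ≠ k)
    (htj : t ≠ j) (htk : t ≠ k) (hjk : j ≠ k) : Function.Injective ![s, t, j, k] := by
  intro x y
  fin_cases x <;> fin_cases y <;>
    simp [hst, hsj, hsk, htj, htk, hjk, hst.symm, hsj.symm, hsk.symm, htj.symm, htk.symm, hjk.symm]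

theorem eq_single_add_single {v : Fin 4 →₀ ℕ} {s t : Fin 4} (hst : s ≠ t)
    (h : ∀ i, i ≠ s → i ≠ t → v i = 0) :
    v = Finsupp.single s (v s) + Finsupp.single t (v t) := by
  ext i
  by_cases his : i = s
  · subst his
    simp [hst]
  · by_cases hit : i = t
    · subst hit
      simp [hst.symm]
    · simp [h i his hit, Ne.symm his, Ne.symm hit]

theorem exists_weightedDegree_eq {s : ℕ} (hs : s ∈ semigroup n) :
    ∃ v, weightedDegree n v = s := by
  induction hs using AddSubmonoid.closure_induction with
  | mem x hx =>
    obtain ⟨i, rfl⟩ := hx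
    exact ⟨Finsupp.single i 1, by simp⟩
  | zero => exact ⟨0, by simp [weightedDegree]⟩
  | add x y _ _ hx hy =>
    obtain ⟨⟨v, rfl⟩, ⟨w, rfl⟩⟩ := And.intro hx hy
    exact ⟨v + w, by simp⟩

/-- A mate `p` is coprime to `q`. If all exponents of `p` are below the critical ones, `p` and `q`
involve two complementary variables each, so `p - q` lies in `𝓘` and `x_1` divides `x^p`. Otherwise
some `x_l^{a_l}` divides `x^p`; substituting its tail gives a monomial sharing a variable with
`x^q`, hence equal to it by minimality. This forces `l = 0` and `x^p = x_1^{a_1}`, whose degree is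
large enough because `n_1` is the smallest weight. -/
theorem exists_partner_of_minimal (hpos : ∀ i, 0 < n i) (hmono : StrictMono n)
    (hcase : IsCaseOne K n a u) (hu : ∀ l, l ≠ 0 → u l 0 ≠ 0)
    (hI : ∀ M N : Fin 4 →₀ ℕ, binomial K M N ∈ indispensableSet K n a → 0 ∈ M.support →
        N.degree ≤ M.degree) {q : Fin 4 →₀ ℕ} (hq : HasMate n q)
    (hmin : ∀ d ≤ q, HasMate n d → d = q) (hq0 : q 0 = 0) (hlt : ∀ k, q k < a k) :
    ∃ p, p 0 ≠ 0 ∧ weightedDegree n p = weightedDegree n q ∧ q.degree ≤ p.degree := by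
  obtain ⟨p, hpq, hw⟩ := hq
  have hdisj := eq_zero_or_eq_zero_of_minimal hmin hpq hw
  obtain ⟨j, k, hjk, hj, hk⟩ := exists_two_ne_zero_of_lt hpos hcase hpq hw hdisj hlt
  have hj0 : j ≠ 0 := fun h => hj (h ▸ hq0)
  have hk0 : k ≠ 0 := fun h => hk (h ▸ hq0)
  by_cases hpa : ∃ l, a l ≤ p l
  · obtain ⟨l, hl⟩ := hpa
    have hal : 0 < a l := (hcase.critical l).1.1.1
    have hql : q l = 0 := (hdisj l).resolve_left (by omega)
    have hlj : l ≠ j := fun h => hj (h ▸ hql)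
    have hlk : l ≠ k := fun h => hk (h ▸ hql)
    obtain ⟨r, rfl, hr⟩ := exists_replace hcase hl
    have hdisj' := fun h => eq_zero_or_eq_zero_of_minimal (p := r + u l) hmin h (hr.trans hw)
    obtain ⟨s, t, hst, hs, ht⟩ := exists_two_ne_zero (hcase.two_le_card_support l)
    have hul : u l l = 0 := (hcase.critical l).2.1
    have hsl : s ≠ l := fun h => hs (h ▸ hul)
    have htl : t ≠ l := fun h => ht (h ▸ hul)
    by_cases hl0 : l = 0
    · subst hl0
      -- Pigeonhole: both pairs lie among the three indices other than `l`.
      have hor : s = j ∨ s = k ∨ t = j ∨ t = k := by omega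
      have heq : r + u 0 = q := by
        by_contra hne
        have h1 := hdisj' hne
        have hs1 := h1 s
        have ht1 := h1 t
        simp only [Finsupp.add_apply] at hs1 ht1
        rcases hor with rfl | rfl | rfl | rfl <;> omega
      refine ⟨_, by simp; omega, hw, ?_⟩
      -- `r` divides both of the coprime monomials `x^p` and `x^q`.
      have hr0 : r = 0 := by
        ext i
        have h1 := DFunLike.congr_fun heq i
        have h2 := hdisj i
        simp only [Finsupp.add_apply, Finsupp.coe_zero, Pi.zero_apply] at h1 h2 ⊢
        by_cases hi : i = 0
        · subst hi; omega
        · omega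
      subst hr0
      have h3 := degree_mul_le_weightedDegree hmono q
      rw [← hw] at h3
      simp only [add_zero, weightedDegree_single, Finsupp.degree_single] at h3 ⊢
      exact Nat.le_of_mul_le_mul_right h3 (hpos 0)
    · exfalso
      -- The tail brings in `x_1`, which does not divide `x^q`, so the new monomial differs from
      -- `x^q` although it shares a variable with it.
      have hu0 := hu l hl0
      have hne : r + u l ≠ q := fun h => by
        have := DFunLike.congr_fun h 0
        simp only [Finsupp.add_apply] at this
        omega
      have h1 := hdisj' hne
      have hs1 := h1 s
      have ht1 := h1 t
      simp only [Finsupp.add_apply] at hs1 ht1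
      have hor : s = j ∨ s = k ∨ t = j ∨ t = k := by omega
      rcases hor with rfl | rfl | rfl | rfl <;> omega
  · push Not at hpa
    obtain ⟨s, t, hst, hs, ht⟩ := exists_two_ne_zero_of_lt hpos hcase hpq.symm hw.symm
      (fun k => (hdisj k).symm) hpa
    have hqs := (hdisj s).resolve_left hs
    have hqt := (hdisj t).resolve_left ht
    have hpj := (hdisj j).resolve_right hj
    have hpk := (hdisj k).resolve_right hk
    have hsj : s ≠ j := fun h => hs (h ▸ hpj)
    have hsk : s ≠ k := fun h => hs (h ▸ hpk)
    have htj : t ≠ j := fun h => ht (h ▸ hpj)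
    have htk : t ≠ k := fun h => ht (h ▸ hpk)
    have hcover : ∀ i, i = s ∨ i = t ∨ i = j ∨ i = k := by omega
    have hp0 : p 0 ≠ 0 := by
      rcases hcover 0 with h | h | h | h
      · rwa [h]
      · rwa [h]
      · exact absurd h.symm hj0
      · exact absurd h.symm hk0
    refine ⟨p, hp0, hw, hI p q ?_ (Finsupp.mem_support_iff.2 hp0)⟩
    have hinj : Function.Injective ![s, t, j, k] :=
      injective_vec_four hst hsj hsk htj htk hjk
    have hps : p = Finsupp.single s (p s) + Finsupp.single t (p t) := by
      refine eq_single_add_single hst fun i his hit => ?_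
      rcases hcover i with h | h | h | h
      exacts [absurd h his, absurd h hit, h ▸ hpj, h ▸ hpk]
    have hqs' : q = Finsupp.single j (q j) + Finsupp.single k (q k) := by
      refine eq_single_add_single hjk fun i hij hik => ?_
      rcases hcover i with h | h | h | h
      exacts [h ▸ hqs, h ▸ hqt, absurd h hij, absurd h hik]
    refine ⟨Equiv.ofBijective _ (Finite.injective_iff_bijective.1 hinj), p s, p t, q j, q k,
      Nat.pos_of_ne_zero hs, hpa s, Nat.pos_of_ne_zero ht, hpa t, Nat.pos_of_ne_zero hj,
      Nat.pos_of_ne_zero hk, ?_, binomial_mem_toricIdeal_iff.2 hw, ?_⟩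
    · change binomial K p q = binomial K (Finsupp.single s (p s) + Finsupp.single t (p t))
        (Finsupp.single j (q j) + Finsupp.single k (q k))
      rw [← hps, ← hqs']
    · change IsIndispensableMonomial K n (Finsupp.single j (q j) + Finsupp.single k (q k))
      rw [← hqs']
      exact isIndispensableMonomial_of_minimal ⟨p, hpq, hw⟩ hmin

/-- A partner of a minimal divisor of `M`, multiplied by the cofactor, is a partner of `M`. -/
theorem hasGoodPartner_of_indispensable (hpos : ∀ i, 0 < n i) (hmono : StrictMono n)
    (hcase : IsCaseOne K n a u) (hu : ∀ l, l ≠ 0 → u l 0 ≠ 0)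
    (hI : ∀ M N : Fin 4 →₀ ℕ, binomial K M N ∈ indispensableSet K n a → 0 ∈ M.support →
        N.degree ≤ M.degree) {M : Fin 4 →₀ ℕ} (hM0 : M 0 = 0) (hlt : ∀ k, M k < a k)
    (hM : MemShift n (weightedDegree n M)) : HasGoodPartner K n M := by
  obtain ⟨s, hs, hMs⟩ := hM
  obtain ⟨v, rfl⟩ := exists_weightedDegree_eq hs
  have hmate : HasMate n M := by
    refine ⟨v + Finsupp.single 0 1, fun h => ?_, by simp [hMs, add_comm]⟩
    simp [← h] at hM0
  obtain ⟨q, hqM, hq, hmin⟩ := exists_minimal_hasMate M hmate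
  obtain ⟨p, hp0, hw, hd⟩ := exists_partner_of_minimal hpos hmono hcase hu hI hq hmin
    (Nat.le_zero.1 (hM0 ▸ hqM 0)) fun k => (hqM k).trans_lt (hlt k)
  obtain ⟨e, rfl⟩ := exists_add_of_le hqM
  refine ⟨p + e, ?_, binomial_mem_toricIdeal_iff.2 (by simp [hw]), by simpa using hd⟩
  simp [hp0]

end MonomialCurve


/-! ### The four cases. -/

open MonomialCurve in
theorem proposition1 (K : Type*) [Field K] (n a : Fin 4 → ℕ) (u : Fin 4 → Fin 4 →₀ ℕ)
    (hpos : ∀ i, 0 < n i) (hmono : StrictMono n) (hgcd : Finset.univ.gcd n = 1)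
    (hcase : IsCaseOne K n a u) (hv : 0 ∈ (u 1).support) :
    -- (i)
    (0 ∈ (u 2).support → 0 ∈ (u 3).support →
      a 1 ≤ (u 1).degree → a 2 ≤ (u 2).degree →
      (∀ M N : Fin 4 →₀ ℕ, binomial K M N ∈ indispensableSet K n a → 0 ∈ M.support →
        N.degree ≤ M.degree) →
      HasCohenMacaulayTangentCone K n) ∧
    -- (ii)
    (0 ∈ (u 2).support → 0 ∉ (u 3).support →
      a 1 ≤ (u 1).degree → a 2 ≤ (u 2).degree →
      (∀ M : Fin 4 →₀ ℕ, M 0 = 0 → M 1 < a 1 → M 2 < a 2 →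
        MemShift n (weightedDegree n M) → HasGoodPartner K n M) →
      HasCohenMacaulayTangentCone K n) ∧
    -- (iii)
    (0 ∉ (u 2).support → 0 ∈ (u 3).support →
      a 1 ≤ (u 1).degree →
      (∀ M : Fin 4 →₀ ℕ, M 0 = 0 → M 1 < a 1 → M 3 < a 3 →
        MemShift n (weightedDegree n M) → HasGoodPartner K n M) →
      HasCohenMacaulayTangentCone K n) ∧
    -- (iv)
    (0 ∉ (u 2).support → 0 ∉ (u 3).support →
      a 1 ≤ (u 1).degree →
      (∀ M : Fin 4 →₀ ℕ, M 0 = 0 → M 1 < a 1 →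
        MemShift n (weightedDegree n M) → HasGoodPartner K n M) →
      HasCohenMacaulayTangentCone K n) := by
  have hd3 := le_degree_three hpos hmono hcase
  refine ⟨fun hw hz h1 h2 hI => ?_, fun hw _ h1 h2 hgood => ?_, fun _ hz h1 hgood => ?_,
    fun _ _ h1 hgood => ?_⟩
  all_goals
    refine hasCohenMacaulayTangentCone_of_hasGoodPartner hpos hmono fun M hM0 hM => ?_
    by_cases hM1 : a 1 ≤ M 1
    · exact hasGoodPartner_of_le hcase hM1 hv h1
  · by_cases hM2 : a 2 ≤ M 2
    · exact hasGoodPartner_of_le hcase hM2 hw h2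
    by_cases hM3 : a 3 ≤ M 3
    · exact hasGoodPartner_of_le hcase hM3 hz hd3
    refine hasGoodPartner_of_indispensable hpos hmono hcase ?_ hI hM0 ?_ hM
    · intro l hl
      fin_cases l
      · exact absurd rfl hl
      · exact Finsupp.mem_support_iff.1 hv
      · exact Finsupp.mem_support_iff.1 hw
      · exact Finsupp.mem_support_iff.1 hz
    · intro k
      fin_cases k
      · exact hM0.trans_lt (hcase.critical 0).1.1.1
      · exact not_le.1 hM1
      · exact not_le.1 hM2
      · exact not_le.1 hM3
  · by_cases hM2 : a 2 ≤ M 2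
    · exact hasGoodPartner_of_le hcase hM2 hw h2
    · exact hgood M hM0 (not_le.1 hM1) (not_le.1 hM2) hM
  · by_cases hM3 : a 3 ≤ M 3
    · exact hasGoodPartner_of_le hcase hM3 hz hd3
    · exact hgood M hM0 (not_le.1 hM1) (not_le.1 hM3) hM
  · exact hgood M hM0 (not_le.1 hM1) hM
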